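/- Let $d\ge 2$, $p=d(d-1)/2$, and let $\boldsymbol X_1,\boldsymbol X_2,\dots$ be i.i.d. random vectors in $\mathbb R^d$ with continuous joint distribution function. Index vectors in $\mathbb R^p$ by the pairs $k=(i,j)$, $1\le i<j\le d$. For $k=(i,j)$ let $$\tau_k=\mathbb P\{(X_i-X_i^*)(X_j-X_j^*)>0\}-\mathbb P\{(X_i-X_i^*)(X_j-X_j^*)<0\}$$ be Kendall's tau, where $\boldsymbol X$ has the common law of the observations and $\boldsymbol X^*$ is an independent copy of $\boldsymbol X$; put $\boldsymbol\tau_p=(\tau_k)_k$. Let $h_k(\boldsymbol x,\boldsymbol y)=2\cdot\mathbb 1\{(x_i-y_i)(x_j-y_j)>0\}-1$, $h=(h_k)_k$, and $$\hat{\boldsymbol\tau}_{np}=\frac{2}{n(n-1)}\sum_{1\le r<s\le n}h(\boldsymbol X_r,\boldsymbol X_s).$$ Let $\boldsymbol\Sigma_p=4\,\mathrm{cov}\{g(\boldsymbol X)\}$ with $g(\boldsymbol x)=\mathbb E\{h(\boldsymbol x,\boldsymbol X)\}-\boldsymbol\tau_p$, and assume that $\boldsymbol\Sigma_p$ is positive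 definite. Let $\boldsymbol B$ be a fixed real $p\times L$ matrix of rank $L<p$. For a $p\times p$ matrix $\boldsymbol S$ put $$\Gamma(\boldsymbol S)=\boldsymbol B(\boldsymbol B^\top\boldsymbol S^{-1}\boldsymbol B)^{-1}\boldsymbol B^\top\boldsymbol S^{-1},\qquad \hat{\boldsymbol\theta}_{np}=\Gamma(\boldsymbol S)\hat{\boldsymbol\tau}_{np},$$ $$E_{np}=(\hat{\boldsymbol\tau}_{np}-\hat{\boldsymbol\theta}_{np})^\top\boldsymbol S^{-1}(\hat{\boldsymbol\tau}_{np}-\hat{\boldsymbol\theta}_{np}),$$ so that $E_{np}=\|\boldsymbol S^{-1/2}(\hat{\boldsymbol\tau}_{np}-\hat{\boldsymbol\theta}_{np})\|_2^2$ when $\boldsymbol S$ is positive definite (where a matrix to be inverted is singular, its inverse is read as $0$). Assume $H_0$: $\boldsymbol\tau_p=\boldsymbol B\boldsymbol\beta$ for some $\boldsymbol\beta\in[-1,1]^L$. Let $\hat{\boldsymbol\Sigma}_{np}$, $n\ge1$, be random $p\times p$ matrices, on the same probability space as the sample, such that $n\hat{\boldsymbol\Sigma}_{np}\to\boldsymbol\Sigma_p$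 in probability, entry by entry, as $n\to\infty$. Then, with $\boldsymbol S=\hat{\boldsymbol\Sigma}_{np}$, $$E_{np}\rightsquigarrow\chi^2_{p-L}\qquad(n\to\infty).$$ -/

import Mathlib

open MeasureTheory ProbabilityTheory Filter Matrix

namespace KendallTest

noncomputable section

/-- The index set of the above-diagonal entries of a `d × d` matrix: the pairs `(i, j)` with
`i < j`. It has `p = d (d - 1) / 2` elements; vectors in `ℝᵖ` and `p × p` matrices are indexed
by it. -/
abbrev Pairs (d : ℕ) : Type := {q : Fin d × Fin d // q.1 < q.2}

/-- Kendall's tau vector `τ_p` of a law `μ` on `ℝᵈ`: for `i < j`, the probability of concordance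
minus the probability of discordance of two independent draws `(x, x*)` from `μ`. -/
def tau {d : ℕ} (μ : Measure (Fin d → ℝ)) (k : Pairs d) : ℝ :=
  (μ.prod μ).real {z | 0 < (z.1 k.1.1 - z.2 k.1.1) * (z.1 k.1.2 - z.2 k.1.2)}
    - (μ.prod μ).real {z | (z.1 k.1.1 - z.2 k.1.1) * (z.1 k.1.2 - z.2 k.1.2) < 0}

/-- The kernel `h_{ij}(x, y) = 2 · 1{(x_i - y_i)(x_j - y_j) > 0} - 1`. -/
def kernel {d : ℕ} (k : Pairs d) (x y : Fin d → ℝ) : ℝ :=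
  2 * (if 0 < (x k.1.1 - y k.1.1) * (x k.1.2 - y k.1.2) then 1 else 0) - 1

/-- The empirical Kendall's tau vector `τ̂_{np}` of the first `n` terms `x 0, …, x (n - 1)`
of a sequence of observations. -/
def tauHat {d : ℕ} (x : ℕ → Fin d → ℝ) (n : ℕ) (k : Pairs d) : ℝ :=
  2 / ((n : ℝ) * ((n : ℝ) - 1)) *
    ∑ s ∈ Finset.range n, ∑ r ∈ Finset.range s, kernel k (x r) (x s)

/-- The function `g(x) = 𝔼 h(x, X) - τ_p`, where `X` has law `μ`. -/
def hajek {d : ℕ} (μ : Measure (Fin d → ℝ)) (k : Pairs d) (x : Fin d → ℝ) : ℝ :=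
  (∫ y, kernel k x y ∂μ) - tau μ k

/-- The asymptotic covariance matrix `Σ_p = 4 cov{g(X)}` of `√n (τ̂_{np} - τ_p)`. -/
def asympCov {d : ℕ} (μ : Measure (Fin d → ℝ)) : Matrix (Pairs d) (Pairs d) ℝ :=
  Matrix.of fun k l => 4 * covariance (hajek μ k) (hajek μ l) μ

/-- The null hypothesis `H₀ : τ_p = B β` for some `β ∈ [-1, 1]ᴸ`. -/
def NullHypothesis {d L : ℕ} (μ : Measure (Fin d → ℝ)) (B : Matrix (Pairs d) (Fin L) ℝ) : Prop :=
  ∃ β : Fin L → ℝ, (∀ l, β l ∈ Set.Icc (-1 : ℝ) 1) ∧ tau μ = B *ᵥ β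

section Statistic

variable {ι κ : Type*} [Fintype ι] [DecidableEq ι] [Fintype κ] [DecidableEq κ]

/-- The projection matrix `Γ(S) = B (Bᵀ S⁻¹ B)⁻¹ Bᵀ S⁻¹`. -/
def Gam (B : Matrix ι κ ℝ) (S : Matrix ι ι ℝ) : Matrix ι ι ℝ :=
  B * (Bᵀ * S⁻¹ * B)⁻¹ * Bᵀ * S⁻¹

/-- The constrained estimator `θ̂ = Γ(S) t` built from the unconstrained estimate `t`; it is
the `S⁻¹`-weighted least squares projection of `t` on the column space of `B`, see
`constrainedEstimator_isMin`. -/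
def constrainedEstimator (B : Matrix ι κ ℝ) (S : Matrix ι ι ℝ) (t : ι → ℝ) : ι → ℝ :=
  Gam B S *ᵥ t

/-- The Euclidean statistic `E = (t - θ̂)ᵀ S⁻¹ (t - θ̂) = ‖S^{-1/2} (t - θ̂)‖₂²`. -/
def euclideanStat (B : Matrix ι κ ℝ) (S : Matrix ι ι ℝ) (t : ι → ℝ) : ℝ :=
  (t - constrainedEstimator B S t) ⬝ᵥ (S⁻¹ *ᵥ (t - constrainedEstimator B S t))

/-- For positive definite `S` and `B` of full column rank, `θ̂` is a linear combination of the
columns of `B`, and it minimises `(t - θ)ᵀ S⁻¹ (t - θ)` over all such `θ`. -/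
theorem constrainedEstimator_isMin {B : Matrix ι κ ℝ} {S : Matrix ι ι ℝ} (hS : S.PosDef)
    (hB : B.rank = Fintype.card κ) (t : ι → ℝ) :
    (∃ β, constrainedEstimator B S t = B *ᵥ β) ∧
      ∀ β, euclideanStat B S t ≤ (t - B *ᵥ β) ⬝ᵥ (S⁻¹ *ᵥ (t - B *ᵥ β)) := by
  have hA : (S⁻¹).PosDef := hS.inv
  have hAT : (S⁻¹)ᵀ = S⁻¹ := by
    simpa [Matrix.IsSymm] using hA.isHermitian
  have hinj : Function.Injective B.mulVec := by
    rw [Matrix.mulVec_injective_iff, linearIndependent_iff_card_eq_finrank_span,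
      ← hB, Matrix.rank_eq_finrank_span_cols]
    rfl
  have hM : (Bᵀ * S⁻¹ * B).PosDef := by
    simpa using hA.conjTranspose_mul_mul_same hinj
  have hdet : IsUnit (Bᵀ * S⁻¹ * B).det := (Matrix.isUnit_iff_isUnit_det _).1 hM.isUnit
  have hmem : constrainedEstimator B S t
      = B *ᵥ (((Bᵀ * S⁻¹ * B)⁻¹ * Bᵀ * S⁻¹) *ᵥ t) := by
    simp [constrainedEstimator, Gam, Matrix.mul_assoc]
  refine ⟨⟨_, hmem⟩, fun β => ?_⟩
  unfold euclideanStat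
  set γ := ((Bᵀ * S⁻¹ * B)⁻¹ * Bᵀ * S⁻¹) *ᵥ t with hγ
  set r := t - constrainedEstimator B S t with hr
  have horth : Bᵀ *ᵥ (S⁻¹ *ᵥ r) = 0 := by
    have h1 : (Bᵀ * S⁻¹ * B) *ᵥ γ = (Bᵀ * S⁻¹) *ᵥ t := by
      rw [hγ, Matrix.mulVec_mulVec, Matrix.mul_assoc _ Bᵀ, ← Matrix.mul_assoc,
        Matrix.mul_nonsing_inv _ hdet, Matrix.one_mul]
    rw [hr, hmem, Matrix.mulVec_mulVec, Matrix.mulVec_sub, Matrix.mulVec_mulVec, h1, sub_self]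
  have hsplit : t - B *ᵥ β = r + B *ᵥ (γ - β) := by
    rw [hr, hmem, Matrix.mulVec_sub]; abel
  have hc : (B *ᵥ (γ - β)) ⬝ᵥ (S⁻¹ *ᵥ r) = 0 := by
    rw [dotProduct_comm, Matrix.dotProduct_mulVec, ← Matrix.mulVec_transpose, horth,
      zero_dotProduct]
  have hc' : r ⬝ᵥ (S⁻¹ *ᵥ (B *ᵥ (γ - β))) = 0 := by
    rw [Matrix.dotProduct_mulVec, ← Matrix.mulVec_transpose, hAT, dotProduct_comm, hc]
  have hnn : 0 ≤ (B *ᵥ (γ - β)) ⬝ᵥ (S⁻¹ *ᵥ (B *ᵥ (γ - β))) := by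
    simpa using hA.posSemidef.dotProduct_mulVec_nonneg (B *ᵥ (γ - β))
  rw [hsplit, Matrix.mulVec_add, add_dotProduct, dotProduct_add, dotProduct_add, hc, hc']
  linarith

/-- If `R` is symmetric with `R R = S⁻¹` (such as `R = S^{-1/2}`), then
`E = ‖R (t - θ̂)‖₂²`. -/
theorem euclideanStat_eq_norm_sq {B : Matrix ι κ ℝ} {S R : Matrix ι ι ℝ} (hR : Rᵀ = R)
    (hRS : R * R = S⁻¹) (t : ι → ℝ) :
    euclideanStat B S t = ‖WithLp.toLp 2 (R *ᵥ (t - constrainedEstimator B S t))‖ ^ 2 := by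
  rw [EuclideanSpace.real_norm_sq_eq, euclideanStat, ← hRS, ← Matrix.mulVec_mulVec,
    Matrix.dotProduct_mulVec, ← Matrix.mulVec_transpose, hR]
  simp [dotProduct, pow_two]

end Statistic

/-- The chi-squared distribution `χ²_k`: the law of `Z₁² + ⋯ + Z_k²` for independent standard
normal `Z₁, …, Z_k`. -/
def chiSquared (k : ℕ) : Measure ℝ :=
  (Measure.pi fun _ : Fin k => gaussianReal 0 1).map fun z => ∑ i, z i ^ 2

instance chiSquared_isProbabilityMeasure (k : ℕ) : IsProbabilityMeasure (chiSquared k) :=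
  Measure.isProbabilityMeasure_map 
    (show Measurable fun z : Fin k → ℝ => ∑ i, z i ^ 2 by fun_prop).aemeasurable

end

end KendallTest

/-!
The statistic is, up to events of vanishing probability, a continuous function of the rescaled
error `Z n = √n (τ̂ - τ)` and of the rescaled matrix `T n = n Σ̂`. The projection `Γ(S)` is invariant
under scaling of `S`, and it fixes the columns of `B`; under the null hypothesis the statistic is
therefore the quadratic form of `Z n` with matrix `M(T n)`, where
`M(S) = (1 - Γ(S))ᵀ S⁻¹ (1 - Γ(S))`, as soon as `T n` and `Bᵀ (T n)⁻¹ B` are invertible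
(`euclideanStat_eq_smul`). `M` is continuous at the positive definite limit `Σ` of `T n`, so that
`M(T n)` tends to `M(Σ)` in probability, and Slutsky's theorem reduces the claim to two facts.

* `tendstoInDistribution_tauHat`: `Z n` tends to `N(0, Σ)` in distribution. A law with continuous
  joint distribution function has no ties (`ae_eval_ne`), hence `τ` is the mean of the kernel `h`,
  and `τ̂` is a U-statistic with mean `τ`. Its difference from the Hájek projection is a U-statistic
  with degenerate kernel, whose second moment is of smaller order because distinct pairs of indices
  give orthogonal terms (`integral_sq_sum_degenerate_le`). The projection is a normalised sum of
  independent vectors with covariance matrix `Σ`, to which the multivariate central limit theorem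
  applies (`tendstoInDistribution_multivariateGaussian`).
* `map_euclideanStat_multivariateGaussian`: if `z` has law `N(0, Σ)`, then `zᵀ M(Σ) z` has law
  `χ²_{p-L}`. The vector `w = Σ^{-1/2} z` is standard Gaussian, and the quadratic form is the squared
  norm of the orthogonal projection of `w` on the complement of the column space of `Σ^{-1/2} B`, a
  space of dimension `p - L`.
-/

namespace KendallTest

/-! ### The statistic as a quadratic form, and its law on Gaussian vectors -/

section LinearAlgebra

open scoped Topology RealInnerProductSpace MatrixOrder

variable {ι κ : Type*}

theorem mulVec_injective_of_rank [Fintype κ] {B : Matrix ι κ ℝ} (hB : B.rank = Fintype.card κ) :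
    Function.Injective B.mulVec := by
  rw [Matrix.mulVec_injective_iff, linearIndependent_iff_card_eq_finrank_span,
    ← hB, Matrix.rank_eq_finrank_span_cols]
  rfl

variable [Fintype ι] [DecidableEq ι]

theorem continuousAt_nonsing_inv {S : Matrix ι ι ℝ} (hS : S.det ≠ 0) :
    ContinuousAt (fun T : Matrix ι ι ℝ => T⁻¹) S := by
  apply continuousAt_matrix_inv
  rw [Ring.inverse_eq_inv']
  exact continuousAt_inv₀ hS

theorem continuousAt_gram (B : Matrix ι κ ℝ) {S : Matrix ι ι ℝ} (hS : S.det ≠ 0) :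
    ContinuousAt (fun T : Matrix ι ι ℝ => Bᵀ * T⁻¹ * B) S :=
  ContinuousAt.comp (f := fun T : Matrix ι ι ℝ => T⁻¹) (g := fun T => Bᵀ * T * B)
    (by fun_prop) (continuousAt_nonsing_inv hS)

variable [Fintype κ]

theorem gram_posDef {B : Matrix ι κ ℝ} {S : Matrix ι ι ℝ} (hS : S.PosDef)
    (hB : B.rank = Fintype.card κ) : (Bᵀ * S⁻¹ * B).PosDef := by
  simpa using hS.inv.conjTranspose_mul_mul_same (mulVec_injective_of_rank hB)

variable [DecidableEq κ]

/-- The matrix of the quadratic form `t ↦ euclideanStat B S t`. -/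
noncomputable def statMatrix (B : Matrix ι κ ℝ) (S : Matrix ι ι ℝ) : Matrix ι ι ℝ :=
  (1 - Gam B S)ᵀ * S⁻¹ * (1 - Gam B S)

theorem euclideanStat_eq_dotProduct (B : Matrix ι κ ℝ) (S : Matrix ι ι ℝ) (t : ι → ℝ) :
    euclideanStat B S t = t ⬝ᵥ (statMatrix B S *ᵥ t) := by
  have h : t - constrainedEstimator B S t = (1 - Gam B S) *ᵥ t := by
    simp [constrainedEstimator, Matrix.sub_mulVec]
  rw [euclideanStat, h, statMatrix, ← Matrix.mulVec_mulVec, ← Matrix.mulVec_mulVec,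
    Matrix.dotProduct_mulVec t, Matrix.vecMul_transpose]

theorem continuousAt_statMatrix (B : Matrix ι κ ℝ) {S : Matrix ι ι ℝ} (hS : S.det ≠ 0)
    (hG : (Bᵀ * S⁻¹ * B).det ≠ 0) : ContinuousAt (statMatrix B) S := by
  have h1 := continuousAt_nonsing_inv hS
  have h2 : ContinuousAt (fun T : Matrix ι ι ℝ => (Bᵀ * T⁻¹ * B)⁻¹) S :=
    ContinuousAt.comp (g := fun T : Matrix κ κ ℝ => T⁻¹) (continuousAt_nonsing_inv hG)
      (continuousAt_gram B hS)
  have h3 := ContinuousAt.comp (x := S)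
    (g := fun Q : Matrix κ κ ℝ × Matrix ι ι ℝ =>
      (1 - B * Q.1 * Bᵀ * Q.2)ᵀ * Q.2 * (1 - B * Q.1 * Bᵀ * Q.2))
    (by fun_prop) (h2.prodMk h1)
  exact h3

theorem Gam_mul_self {B : Matrix ι κ ℝ} {S : Matrix ι ι ℝ} (hG : (Bᵀ * S⁻¹ * B).det ≠ 0) :
    Gam B S * B = B := by
  rw [Gam, Matrix.mul_assoc (B * _ * Bᵀ), Matrix.mul_assoc (B * _), ← Matrix.mul_assoc Bᵀ,
    Matrix.mul_assoc B, Matrix.nonsing_inv_mul _ hG.isUnit, Matrix.mul_one]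

/-- `Γ(S)` fixes the columns of `B`, so under the null hypothesis `τ = B β` the estimate may be
replaced by its error `τ̂ - τ`. -/
theorem euclideanStat_sub_mulVec {B : Matrix ι κ ℝ} {S : Matrix ι ι ℝ}
    (hG : (Bᵀ * S⁻¹ * B).det ≠ 0) (t : ι → ℝ) (β : κ → ℝ) :
    euclideanStat B S (t - B *ᵥ β) = euclideanStat B S t := by
  have h : t - B *ᵥ β - constrainedEstimator B S (t - B *ᵥ β)
      = t - constrainedEstimator B S t := by
    rw [constrainedEstimator, constrainedEstimator, Matrix.mulVec_sub, Matrix.mulVec_mulVec,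
      Gam_mul_self hG]
    abel
  rw [euclideanStat, euclideanStat, h]

theorem euclideanStat_smul (B : Matrix ι κ ℝ) (S : Matrix ι ι ℝ) (a : ℝ) (t : ι → ℝ) :
    euclideanStat B S (a • t) = a ^ 2 * euclideanStat B S t := by
  simp [euclideanStat_eq_dotProduct, Matrix.mulVec_smul]
  ring

theorem inv_smul_of_ne_zero {S : Matrix ι ι ℝ} {c : ℝ} (hc : c ≠ 0) (hS : (c • S).det ≠ 0) :
    S⁻¹ = c • (c • S)⁻¹ := by
  have hS' : IsUnit S.det := by
    rw [Matrix.det_smul] at hS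
    exact (right_ne_zero_of_mul hS).isUnit
  have := invertibleOfNonzero hc
  rw [Matrix.inv_smul S c hS', smul_smul, mul_invOf_self, one_smul]

/-- The projection `Γ(S)` does not depend on the scale of `S`, so rescaling the estimate by `√n`
amounts to rescaling `S` by `n`. The invertibility hypotheses are needed because the inverse of a
singular matrix is read as `0`. -/
theorem euclideanStat_eq_smul (B : Matrix ι κ ℝ) {S : Matrix ι ι ℝ} {c : ℝ} (hc : 0 < c)
    (hS : (c • S).det ≠ 0) (hG : (Bᵀ * (c • S)⁻¹ * B).det ≠ 0) (t : ι → ℝ) (β : κ → ℝ) :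
    euclideanStat B S t = euclideanStat B (c • S) (√c • (t - B *ᵥ β)) := by
  rw [euclideanStat_smul, euclideanStat_sub_mulVec hG, Real.sq_sqrt hc.le]
  have hI := inv_smul_of_ne_zero hc.ne' hS
  have hc' := invertibleOfNonzero hc.ne'
  have hgam : Gam B S = Gam B (c • S) := by
    rw [Gam, Gam, hI, Matrix.mul_smul Bᵀ, Matrix.smul_mul, Matrix.inv_smul _ c hG.isUnit]
    simp [smul_smul]
  rw [euclideanStat_eq_dotProduct, euclideanStat_eq_dotProduct, statMatrix, statMatrix, hgam, hI]
  simp [Matrix.smul_mulVec]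

/-- The coefficients of a standard Gaussian vector along an orthonormal family are independent
standard normal variables, so the sum of their squares is chi-squared. -/
theorem map_sum_sq_inner_stdGaussian {E : Type*} [NormedAddCommGroup E] [InnerProductSpace ℝ E]
    [FiniteDimensional ℝ E] [MeasurableSpace E] [BorelSpace E] {m : ℕ} {u : Fin m → E}
    (hu : Orthonormal ℝ u) :
    (stdGaussian E).map (fun w => ∑ i, ⟪u i, w⟫ ^ 2) = chiSquared m := by
  have hlaw : (stdGaussian E).map (fun w => WithLp.toLp 2 fun i => ⟪u i, w⟫)
      = stdGaussian (EuclideanSpace ℝ (Fin m)) := by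
    have hm : Measurable fun w : E => WithLp.toLp 2 fun i => ⟪u i, w⟫ := by fun_prop
    have := Measure.isProbabilityMeasure_map (μ := stdGaussian E) hm.aemeasurable
    apply Measure.ext_of_charFun
    ext t
    have h1 : ∀ w : E, ⟪WithLp.toLp 2 fun i => ⟪u i, w⟫, t⟫ = ⟪w, ∑ i, t i • u i⟫ := by
      intro w
      simp [PiLp.inner_apply, inner_sum, inner_smul_right, real_inner_comm]
    have h2 : ‖∑ i, t i • u i‖ ^ 2 = ‖t‖ ^ 2 := by
      rw [← real_inner_self_eq_norm_sq, hu.inner_sum, EuclideanSpace.real_norm_sq_eq]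
      simp [sq]
    rw [charFun_stdGaussian, charFun_apply, integral_map hm.aemeasurable (by fun_prop)]
    simp_rw [h1]
    rw [← charFun_apply, charFun_stdGaussian, ← Complex.ofReal_pow, h2]
    simp
  have h3 : (fun w : E => ∑ i, ⟪u i, w⟫ ^ 2)
      = (fun x : EuclideanSpace ℝ (Fin m) => ∑ i, x i ^ 2)
        ∘ fun w => WithLp.toLp 2 fun i => ⟪u i, w⟫ := rfl
  rw [h3, ← Measure.map_map (by fun_prop) (by fun_prop), hlaw, ← map_pi_eq_stdGaussian,
    Measure.map_map (by fun_prop) (by fun_prop)]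
  rfl

/-- With `R = S^{-1/2}`, the vector `R (t - θ̂)` is the orthogonal projection of `R t` on the
orthogonal complement of the column space of `R B`, which has dimension `card ι - card κ`. -/
theorem exists_orthonormal_euclideanStat_eq {B : Matrix ι κ ℝ} {S R : Matrix ι ι ℝ}
    (hS : S.PosDef) (hB : B.rank = Fintype.card κ) (hR : Rᵀ = R) (hRS : R * R = S⁻¹) :
    ∃ u : Fin (Fintype.card ι - Fintype.card κ) → EuclideanSpace ℝ ι, Orthonormal ℝ u ∧
      ∀ t : ι → ℝ, euclideanStat B S t = ∑ i, ⟪u i, WithLp.toLp 2 (R *ᵥ t)⟫ ^ 2 := by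
  set f : EuclideanSpace ℝ κ →ₗ[ℝ] EuclideanSpace ℝ ι := Matrix.toEuclideanLin (R * B) with hf
  have hRdet : R.det ≠ 0 := by
    intro h
    have h1 : (R * R).det = 0 := by simp [h]
    rw [hRS] at h1
    exact hS.inv.det_pos.ne' h1
  have hinj : Function.Injective f := by
    intro x y hxy
    have h1 : R *ᵥ (B *ᵥ x.ofLp) = R *ᵥ (B *ᵥ y.ofLp) := by
      simpa [hf, Matrix.toLpLin_apply, Matrix.mulVec_mulVec] using congrArg WithLp.ofLp hxy
    have h2 := Matrix.mulVec_injective_of_isUnit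
      ((Matrix.isUnit_iff_isUnit_det R).2 hRdet.isUnit) h1
    exact WithLp.ofLp_injective 2 (mulVec_injective_of_rank hB h2)
  set V := LinearMap.range f with hV
  have hfin : Module.finrank ℝ Vᗮ = Fintype.card ι - Fintype.card κ := by
    have h1 := V.finrank_add_finrank_orthogonal
    have h2 : Module.finrank ℝ V = Fintype.card κ := by
      rw [hV, LinearMap.finrank_range_of_inj hinj, finrank_euclideanSpace]
    rw [finrank_euclideanSpace] at h1
    omega
  let b := (stdOrthonormalBasis ℝ Vᗮ).reindex (finCongr hfin)
  refine ⟨fun i => (b i : EuclideanSpace ℝ ι), ?_, fun t => ?_⟩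
  · exact b.orthonormal.comp_linearIsometry Vᗮ.subtypeₗᵢ
  have hG := (gram_posDef hS hB).det_pos.ne'
  set r := t - constrainedEstimator B S t with hr
  have horth : Bᵀ *ᵥ (S⁻¹ *ᵥ r) = 0 := by
    have h1 : Bᵀ * S⁻¹ * Gam B S = Bᵀ * S⁻¹ := by
      simp only [Gam]
      rw [← Matrix.mul_assoc, ← Matrix.mul_assoc, ← Matrix.mul_assoc,
        Matrix.mul_nonsing_inv _ hG.isUnit, Matrix.one_mul]
    rw [hr, constrainedEstimator, Matrix.mulVec_mulVec, Matrix.mulVec_sub, Matrix.mulVec_mulVec,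
      h1, sub_self]
  have hmem : WithLp.toLp 2 (R *ᵥ r) ∈ Vᗮ := by
    rw [Submodule.mem_orthogonal]
    rintro _ ⟨x, rfl⟩
    rw [hf, Matrix.toLpLin_apply, EuclideanSpace.inner_toLp_toLp]
    simp only [star_trivial]
    rw [dotProduct_comm, ← Matrix.mulVec_mulVec, ← Matrix.vecMul_transpose,
      ← Matrix.dotProduct_mulVec, hR, Matrix.mulVec_mulVec, hRS,
      ← Matrix.vecMul_transpose, ← Matrix.dotProduct_mulVec, horth, dotProduct_zero]
  have hsub : WithLp.toLp 2 (R *ᵥ t) - WithLp.toLp 2 (R *ᵥ r) ∈ V := by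
    refine ⟨WithLp.toLp 2 (((Bᵀ * S⁻¹ * B)⁻¹ * Bᵀ * S⁻¹) *ᵥ t), ?_⟩
    rw [hf, Matrix.toLpLin_apply, ← WithLp.toLp_sub, ← Matrix.mulVec_sub, hr, sub_sub_cancel,
      constrainedEstimator, Gam]
    simp [Matrix.mul_assoc]
  rw [euclideanStat_eq_norm_sq hR hRS, ← hr,
    show ‖WithLp.toLp 2 (R *ᵥ r)‖ = ‖(⟨_, hmem⟩ : Vᗮ)‖ from rfl, ← b.sum_sq_inner_right]
  refine Finset.sum_congr rfl fun i _ => ?_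
  have h0 : ⟪(b i : EuclideanSpace ℝ ι), WithLp.toLp 2 (R *ᵥ t) - WithLp.toLp 2 (R *ᵥ r)⟫ = 0 :=
    Submodule.inner_left_of_mem_orthogonal hsub (b i).2
  rw [inner_sub_right, sub_eq_zero] at h0
  rw [h0]
  rfl

/-- The statistic of a centred Gaussian vector with covariance matrix `S` is chi-squared. -/
theorem map_euclideanStat_multivariateGaussian {B : Matrix ι κ ℝ} {S : Matrix ι ι ℝ}
    (hS : S.PosDef) (hB : B.rank = Fintype.card κ) :
    (multivariateGaussian 0 S).map (fun z => euclideanStat B S z.ofLp)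
      = chiSquared (Fintype.card ι - Fintype.card κ) := by
  have hAA : CFC.sqrt S * CFC.sqrt S = S := CFC.sqrt_mul_sqrt_self S hS.posSemidef.nonneg
  have hAT : (CFC.sqrt S)ᵀ = CFC.sqrt S := by
    simpa [Matrix.star_eq_conjTranspose] using (CFC.sqrt_nonneg S).isSelfAdjoint.star_eq
  have hdet : IsUnit (CFC.sqrt S).det := by
    refine (isUnit_iff_ne_zero.2 fun h => hS.det_pos.ne' ?_)
    rw [← hAA, Matrix.det_mul, h, zero_mul]
  obtain ⟨u, hu, hstat⟩ := exists_orthonormal_euclideanStat_eq (R := (CFC.sqrt S)⁻¹) hS hB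
    (by rw [Matrix.transpose_nonsing_inv, hAT]) (by rw [← Matrix.mul_inv_rev, hAA])
  have hm : Measurable fun z : EuclideanSpace ℝ ι => euclideanStat B S z.ofLp := by
    simp_rw [hstat]
    have h : ∀ z : EuclideanSpace ℝ ι, WithLp.toLp 2 ((CFC.sqrt S)⁻¹ *ᵥ z.ofLp)
      = toEuclideanCLM (𝕜 := ℝ) (CFC.sqrt S)⁻¹ z := fun z => rfl
    simp_rw [h]
    fun_prop
  rw [multivariateGaussian, Measure.map_map hm (by fun_prop), ← map_sum_sq_inner_stdGaussian hu]
  congr 1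
  ext w
  simp [hstat, Matrix.mulVec_mulVec, Matrix.nonsing_inv_mul _ hdet]

end LinearAlgebra

/-! ### Convergence in probability and the multivariate central limit theorem -/

section Probability

open scoped Topology RealInnerProductSpace ENNReal

variable {Ω : Type*} [MeasurableSpace Ω] {P : Measure Ω}

/-- If `X n` tends to the constant `c` in probability, then `X n` lies in a fixed neighbourhood
of `c` with probability tending to one. -/
theorem tendsto_measure_notMem_of_mem_nhds {E : Type*} [PseudoMetricSpace E] {X : ℕ → Ω → E}
    {c : E} (hX : TendstoInMeasure P X atTop fun _ => c) {U : Set E} (hU : U ∈ 𝓝 c) :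
    Tendsto (fun n => P {ω | X n ω ∉ U}) atTop (𝓝 0) := by
  obtain ⟨ε, hε, hball⟩ := Metric.mem_nhds_iff.1 hU
  refine tendsto_of_tendsto_of_tendsto_of_le_of_le tendsto_const_nhds
    (tendstoInMeasure_iff_dist.1 hX ε hε) (fun _ => zero_le) fun n => measure_mono fun ω hω => ?_
  by_contra h
  exact hω (hball (Metric.mem_ball.2 (not_le.1 h)))

theorem tendstoInMeasure_comp_of_continuousAt {E F : Type*} [PseudoMetricSpace E]
    [PseudoMetricSpace F] {X : ℕ → Ω → E} {c : E} {f : E → F}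
    (hX : TendstoInMeasure P X atTop fun _ => c) (hf : ContinuousAt f c) :
    TendstoInMeasure P (fun n ω => f (X n ω)) atTop fun _ => f c := by
  refine tendstoInMeasure_iff_dist.2 fun ε hε => ?_
  have h := tendsto_measure_notMem_of_mem_nhds hX (hf.preimage_mem_nhds (Metric.ball_mem_nhds _ hε))
  simpa using h

theorem tendstoInMeasure_pi {ι : Type*} [Fintype ι] {F : ι → Type*}
    [∀ i, PseudoMetricSpace (F i)] {X : ℕ → Ω → ∀ i, F i} {Y : Ω → ∀ i, F i}
    (hX : ∀ i, TendstoInMeasure P (fun n ω => X n ω i) atTop fun ω => Y ω i) :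
    TendstoInMeasure P X atTop Y := by
  refine tendstoInMeasure_iff_dist.2 fun ε hε => ?_
  have h : Tendsto (fun n => ∑ i, P {ω | ε ≤ dist (X n ω i) (Y ω i)}) atTop (𝓝 0) := by
    simpa using tendsto_finsetSum Finset.univ fun i _ => tendstoInMeasure_iff_dist.1 (hX i) ε hε
  refine tendsto_of_tendsto_of_tendsto_of_le_of_le tendsto_const_nhds h
    (fun _ => zero_le) fun n => ?_
  refine (measure_mono (t := ⋃ i, {ω | ε ≤ dist (X n ω i) (Y ω i)}) fun ω hω => ?_).trans
    (measure_iUnion_fintype_le _ _)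
  by_contra hn
  simp only [Set.mem_iUnion, Set.mem_ofPred_eq, not_exists, not_le] at hn
  exact absurd hω (not_le.2 ((dist_pi_lt_iff hε).2 hn))

/-- Variables that agree outside events of vanishing probability differ by a sequence tending to
zero in probability. -/
theorem tendstoInMeasure_sub_of_eq {X Y : ℕ → Ω → ℝ} {A : ℕ → Set Ω}
    (hA : Tendsto (fun n => P (A n)) atTop (𝓝 0))
    (h : ∀ᶠ n in atTop, ∀ ω, ω ∉ A n → Y n ω = X n ω) :
    TendstoInMeasure P (Y - X) atTop 0 := by
  refine tendstoInMeasure_iff_dist.2 fun ε hε => ?_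
  refine tendsto_of_tendsto_of_tendsto_of_le_of_le' tendsto_const_nhds hA
    (Eventually.of_forall fun _ => zero_le) ?_
  filter_upwards [h] with n hn
  refine measure_mono fun ω hω => ?_
  by_contra hnot
  have h0 : (Y - X) n ω = 0 := by simp [hn ω hnot]
  simp only [Set.mem_ofPred_eq, h0, Pi.zero_apply, dist_self] at hω
  exact absurd hε (not_lt.2 hω)

/-- Chebyshev's inequality: second moments tending to zero force convergence in probability. -/
theorem tendstoInMeasure_zero_of_integral_sq [IsFiniteMeasure P] {X : ℕ → Ω → ℝ}
    (hX : ∀ n, MemLp (X n) 2 P)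
    (h : Tendsto (fun n => ∫ ω, X n ω ^ 2 ∂P) atTop (𝓝 0)) :
    TendstoInMeasure P X atTop 0 := by
  refine tendstoInMeasure_of_tendsto_eLpNorm (p := 2) (by simp)
    (fun n => (hX n).aestronglyMeasurable) (by fun_prop) ?_
  have h1 : ∀ n, eLpNorm (X n - 0) 2 P = ENNReal.ofReal (√(∫ ω, X n ω ^ 2 ∂P)) := by
    intro n
    rw [sub_zero, (hX n).eLpNorm_eq_integral_rpow_norm (by simp) (by simp)]
    simp [Real.sqrt_eq_rpow]
  simp_rw [h1]
  rw [← ENNReal.ofReal_zero]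
  refine ENNReal.tendsto_ofReal ?_
  simpa using h.sqrt

/-- The central limit theorem in `ℝᵖ`, obtained from the one-dimensional theorem for the linear
forms `⟨Y r, t⟩` through characteristic functions. -/
theorem tendstoInDistribution_multivariateGaussian [IsProbabilityMeasure P]
    {ι : Type*} [Fintype ι] [DecidableEq ι] {Y : ℕ → Ω → EuclideanSpace ℝ ι}
    (hY : MemLp (Y 0) 2 P) (hmean : ∀ i, ∫ ω, Y 0 ω i ∂P = 0) {S : Matrix ι ι ℝ}
    (hS : S.PosSemidef) (hcov : ∀ i j, cov[fun ω => Y 0 ω i, fun ω => Y 0 ω j; P] = S i j)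
    (hindep : iIndepFun Y P) (hident : ∀ r, IdentDistrib (Y r) (Y 0) P P) :
    TendstoInDistribution (fun (n : ℕ) ω => (√n)⁻¹ • ∑ r ∈ Finset.range n, Y r ω) atTop
      id (fun _ => P) (multivariateGaussian 0 S) where
  forall_aemeasurable n :=
    (Finset.aemeasurable_fun_sum _ fun r _ => (hident r).aemeasurable_fst).fun_const_smul (√n)⁻¹
  tendsto := by
    refine ProbabilityMeasure.tendsto_iff_tendsto_charFun.2 fun t => ?_
    simp only [ProbabilityMeasure.coe_mk, Measure.map_id]
    have hmem : ∀ i, MemLp (fun ω => Y 0 ω i) 2 P := fun i =>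
      (EuclideanSpace.proj i : EuclideanSpace ℝ ι →L[ℝ] ℝ).comp_memLp' hY
    have hform : ∀ x : EuclideanSpace ℝ ι, ⟪x, t⟫ = ∑ i, t i * x i := fun x => by
      simp [PiLp.inner_apply]
    have h0 : ∫ ω, ⟪Y 0 ω, t⟫ ∂P = 0 := by
      simp_rw [hform]
      rw [integral_finsetSum _ fun i _ => ((hmem i).integrable (by simp)).const_mul _]
      simp [integral_const_mul, hmean]
    have hvar : Var[fun ω => ⟪Y 0 ω, t⟫; P] = t.ofLp ⬝ᵥ S *ᵥ t.ofLp := by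
      simp_rw [hform]
      rw [variance_fun_sum fun i => (hmem i).const_mul _]
      simp_rw [covariance_const_mul_left, covariance_const_mul_right, hcov]
      simp [dotProduct, Matrix.mulVec, Finset.mul_sum, mul_comm, mul_left_comm]
    -- the characteristic function at `t` is that of the linear form `⟨·, t⟩` at `1`
    have hclt := tendstoInDistribution_inv_sqrt_mul_sum_sub (P := P)
      (X := fun r ω => ⟪Y r ω, t⟫) (HasLaw.id (μ := gaussianReal 0 _))
      (hY.inner_const t) (hindep.comp (fun _ x => ⟪x, t⟫) (by fun_prop))
      (fun r => (hident r).comp (u := fun x => ⟪x, t⟫) (by fun_prop))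
    have h1 := ProbabilityMeasure.tendsto_iff_tendsto_charFun.1 hclt.tendsto 1
    simp only [ProbabilityMeasure.coe_mk, Measure.map_id, charFun_gaussianReal, h0, hvar] at h1
    rw [charFun_multivariateGaussian hS]
    convert! h1 using 1
    · ext n
      rw [charFun_apply, charFun_apply, integral_map, integral_map]
      · simp [real_inner_smul_left, sum_inner]
      · exact hclt.forall_aemeasurable n |>.congr (by simp [h0])
      · fun_prop
      · exact (Finset.aemeasurable_fun_sum _ fun r _ => (hident r).aemeasurable_fst).fun_const_smul _
      · fun_prop
    · have : 0 ≤ t.ofLp ⬝ᵥ S *ᵥ t.ofLp := by simpa using hS.dotProduct_mulVec_nonneg t.ofLp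
      simp [Real.coe_toNNReal _ this]

end Probability

/-! ### Hájek projection of U-statistics -/

section UStatistic

open scoped Topology

variable {Ω α : Type*} [MeasurableSpace Ω] [MeasurableSpace α] {P : Measure Ω}
  [IsProbabilityMeasure P] {μ : Measure α} {X : ℕ → Ω → α}

/-- A term of the expanded square vanishes as soon as one index occurs only once in it: integrate
first over the corresponding observation. -/
theorem integral_kernel_mul_kernel_eq_zero (hlaw : ∀ r, HasLaw (X r) μ P) (hindep : iIndepFun X P)
    {h : α → α → ℝ} (hm : Measurable (Function.uncurry h)) {C : ℝ} (hC : ∀ x y, |h x y| ≤ C)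
    (hdeg : ∀ x, ∫ y, h x y ∂μ = 0) {a b c e : ℕ} (hea : e ≠ a) (heb : e ≠ b) (hec : e ≠ c) :
    ∫ ω, h (X a ω) (X e ω) * h (X b ω) (X c ω) ∂P = 0 := by
  have hμ : IsProbabilityMeasure μ := (hlaw 0).isProbabilityMeasure_iff.1 ‹_›
  have hX : ∀ r, AEMeasurable (X r) P := fun r => (hlaw r).aemeasurable
  let S : Finset ℕ := {a, b, c}
  let W : Ω → S → α := fun ω i => X i ω
  have hW : AEMeasurable W P := aemeasurable_pi_lambda _ fun i => hX i
  have hind : IndepFun W (X e) P :=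
    (hindep.indepFun_finset₀ S {e} (by simp [S, hea, heb, hec]) hX).comp
      measurable_id (measurable_pi_apply (⟨e, by simp⟩ : ({e} : Finset ℕ)))
  have hprod := (indepFun_iff_map_prod_eq_prod_map_map hW (hX e)).1 hind
  rw [(hlaw e).map_eq] at hprod
  have hPW := Measure.isProbabilityMeasure_map hW
  let ia : S := ⟨a, by simp [S]⟩
  let ib : S := ⟨b, by simp [S]⟩
  let ic : S := ⟨c, by simp [S]⟩
  let F : (S → α) × α → ℝ := fun z => h (z.1 ia) z.2 * h (z.1 ib) (z.1 ic)
  have hF : Measurable F :=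
    (hm.comp (f := fun z : (S → α) × α => (z.1 ia, z.2)) (by fun_prop)).mul
      (hm.comp (f := fun z : (S → α) × α => (z.1 ib, z.1 ic)) (by fun_prop))
  have hFint : Integrable F ((P.map W).prod μ) := by
    refine .of_bound hF.aestronglyMeasurable (C * C) (.of_forall fun z => ?_)
    rw [Real.norm_eq_abs, abs_mul]
    exact mul_le_mul (hC _ _) (hC _ _) (abs_nonneg _) ((abs_nonneg _).trans (hC (z.1 ia) z.2))
  calc ∫ ω, h (X a ω) (X e ω) * h (X b ω) (X c ω) ∂P
      = ∫ z, F z ∂(P.map fun ω => (W ω, X e ω)) := by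
        rw [integral_map (hW.prodMk (hX e)) hF.aestronglyMeasurable]
    _ = ∫ w, ∫ y, h (w ia) y * h (w ib) (w ic) ∂μ ∂(P.map W) := by
        rw [hprod, integral_prod _ hFint]
    _ = 0 := by simp_rw [integral_mul_const, hdeg, zero_mul, integral_zero]

/-- The sum over pairs of a degenerate kernel has `O(n²)` second moment: of the `O(n⁴)` terms of
the expanded square only the diagonal ones survive. -/
theorem integral_sq_sum_degenerate_le (hlaw : ∀ r, HasLaw (X r) μ P) (hindep : iIndepFun X P)
    {h : α → α → ℝ} (hm : Measurable (Function.uncurry h)) {C : ℝ} (hC : ∀ x y, |h x y| ≤ C)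
    (hsymm : ∀ x y, h x y = h y x) (hdeg : ∀ x, ∫ y, h x y ∂μ = 0) (n : ℕ) :
    ∫ ω, (∑ s ∈ Finset.range n, ∑ r ∈ Finset.range s, h (X r ω) (X s ω)) ^ 2 ∂P
      ≤ C ^ 2 * n ^ 2 := by
  have hX : ∀ r, AEMeasurable (X r) P := fun r => (hlaw r).aemeasurable
  let I : Finset (Σ _ : ℕ, ℕ) := (Finset.range n).sigma Finset.range
  let a : (Σ _ : ℕ, ℕ) → Ω → ℝ := fun p ω => h (X p.2 ω) (X p.1 ω)
  have ham : ∀ p, AEMeasurable (a p) P := fun p =>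
    hm.comp_aemeasurable ((hX p.2).prodMk (hX p.1))
  have hint : ∀ p q, Integrable (fun ω => a p ω * a q ω) P := fun p q => by
    refine .of_bound ((ham p).mul (ham q)).aestronglyMeasurable (C * C) (.of_forall fun ω => ?_)
    rw [Real.norm_eq_abs, abs_mul]
    exact mul_le_mul (hC _ _) (hC _ _) (abs_nonneg _)
      ((abs_nonneg _).trans (hC (X p.2 ω) (X p.1 ω)))
  have horth : ∀ p ∈ I, ∀ q ∈ I, q ≠ p → ∫ ω, a p ω * a q ω ∂P = 0 := by
    rintro ⟨s, r⟩ hp ⟨s', r'⟩ hq hne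
    simp only [I, Finset.mem_sigma, Finset.mem_range] at hp hq
    by_cases h1 : s = s' ∨ s = r'
    · -- here the smaller index `r` of the first pair does not occur in the second one
      have h2 : r ≠ r' ∧ r ≠ s' := by
        rcases h1 with rfl | rfl
        · exact ⟨fun h => hne (by rw [h]), by omega⟩
        · omega
      simp only [a]
      simp_rw [hsymm (X r _) (X s _)]
      exact integral_kernel_mul_kernel_eq_zero hlaw hindep hm hC hdeg hp.2.ne h2.1 h2.2
    · -- here the larger index `s` of the first pair does not occur in the second one
      push Not at h1
      exact integral_kernel_mul_kernel_eq_zero hlaw hindep hm hC hdeg hp.2.ne' h1.2 h1.1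
  have hsum : ∀ ω, (∑ s ∈ Finset.range n, ∑ r ∈ Finset.range s, h (X r ω) (X s ω)) ^ 2
      = ∑ p ∈ I, ∑ q ∈ I, a p ω * a q ω := fun ω => by
    rw [← Finset.sum_mul_sum, ← sq, Finset.sum_sigma]
  have hcard : (I.card : ℝ) ≤ n ^ 2 := by
    have h1 : I.card ≤ n ^ 2 := by
      rw [Finset.card_sigma, sq]
      refine (Finset.sum_le_card_nsmul _ _ n fun s hs => ?_).trans (by simp)
      simpa using (Finset.mem_range.1 hs).le
    exact_mod_cast h1
  have hdiag : ∀ p, ∫ ω, a p ω * a p ω ∂P ≤ C ^ 2 := fun p => by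
    have h1 : ∫ ω, a p ω * a p ω ∂P ≤ ∫ _, C ^ 2 ∂P :=
      integral_mono (hint p p) (integrable_const _) fun ω => by
        rw [← sq]
        exact sq_le_sq' (abs_le.1 (hC _ _)).1 (abs_le.1 (hC _ _)).2
    simpa using h1
  simp_rw [hsum]
  rw [integral_finsetSum _ fun p _ => integrable_finsetSum _ fun q _ => hint p q]
  calc ∑ p ∈ I, ∫ ω, ∑ q ∈ I, a p ω * a q ω ∂P
      = ∑ p ∈ I, ∫ ω, a p ω * a p ω ∂P := Finset.sum_congr rfl fun p hp => by
        rw [integral_finsetSum _ fun q _ => hint p q]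
        exact Finset.sum_eq_single p (horth p hp) fun h => absurd hp h
    _ ≤ ∑ _p ∈ I, C ^ 2 := Finset.sum_le_sum fun p _ => hdiag p
    _ = C ^ 2 * I.card := by rw [Finset.sum_const, nsmul_eq_mul, mul_comm]
    _ ≤ C ^ 2 * n ^ 2 := by gcongr

theorem sum_range_sum_range_add (g : ℕ → ℝ) (n : ℕ) :
    ∑ s ∈ Finset.range n, ∑ r ∈ Finset.range s, (g r + g s)
      = ((n : ℝ) - 1) * ∑ r ∈ Finset.range n, g r := by
  induction n with
  | zero => simp
  | succ n ih =>
    rw [Finset.sum_range_succ, ih, Finset.sum_range_succ, Finset.sum_add_distrib]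
    simp
    ring

theorem sum_range_sum_range_const (θ : ℝ) (n : ℕ) :
    ∑ s ∈ Finset.range n, ∑ _r ∈ Finset.range s, θ = (n : ℝ) * ((n : ℝ) - 1) / 2 * θ := by
  induction n with
  | zero => simp
  | succ n ih =>
    rw [Finset.sum_range_succ, ih]
    simp
    ring

/-- Hoeffding's decomposition: after removal of its mean and of its linear part
`2 n⁻¹ ∑ g (X r)`, what is left of the U-statistic is the U-statistic of the degenerate kernel
`k x y - θ - g x - g y`. -/
theorem sqrt_mul_uStatistic_sub_projection {n : ℕ} (hn : 2 ≤ n) (k : ℕ → ℕ → ℝ) (g : ℕ → ℝ)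
    (θ : ℝ) :
    √n * (2 / ((n : ℝ) * ((n : ℝ) - 1)) *
        ∑ s ∈ Finset.range n, ∑ r ∈ Finset.range s, k r s - θ)
      - (√n)⁻¹ * ∑ r ∈ Finset.range n, 2 * g r
      = 2 * √n / ((n : ℝ) * ((n : ℝ) - 1)) *
        ∑ s ∈ Finset.range n, ∑ r ∈ Finset.range s, (k r s - θ - g r - g s) := by
  have hn' : (2 : ℝ) ≤ n := by exact_mod_cast hn
  have h1 : (n : ℝ) - 1 ≠ 0 := by linarith
  have h0 : (0 : ℝ) < n := by linarith
  have hs : √(n : ℝ) ≠ 0 := (Real.sqrt_pos.2 h0).ne'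
  have hss : √(n : ℝ) * √n = n := Real.mul_self_sqrt h0.le
  have hinv : (√(n : ℝ))⁻¹ = √n / n := by
    rw [eq_div_iff h0.ne', inv_mul_eq_div, div_eq_iff hs, hss]
  have hsplit : ∑ s ∈ Finset.range n, ∑ r ∈ Finset.range s, (k r s - θ - g r - g s)
      = ∑ s ∈ Finset.range n, ∑ r ∈ Finset.range s, k r s
        - (n : ℝ) * ((n : ℝ) - 1) / 2 * θ - ((n : ℝ) - 1) * ∑ r ∈ Finset.range n, g r := by
    rw [← sum_range_sum_range_add, ← sum_range_sum_range_const]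
    simp only [← Finset.sum_sub_distrib]
    exact Finset.sum_congr rfl fun s _ => Finset.sum_congr rfl fun r _ => by ring
  rw [hsplit, hinv, ← Finset.mul_sum]
  field_simp

/-- The Hájek projection of a U-statistic with bounded symmetric kernel `k`: up to a term tending
to zero in probability, `√n (U_n - θ)` is the normalised sum of the variables `2 g (X r)`. -/
theorem tendstoInMeasure_uStatistic_sub_projection (hlaw : ∀ r, HasLaw (X r) μ P)
    (hindep : iIndepFun X P) {k : α → α → ℝ} (hm : Measurable (Function.uncurry k)) {C : ℝ}
    (hC : ∀ x y, |k x y| ≤ C) (hsymm : ∀ x y, k x y = k y x) {g : α → ℝ} {θ : ℝ}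
    (hg : ∀ x, g x = (∫ y, k x y ∂μ) - θ) (hθ : ∫ x, ∫ y, k x y ∂μ ∂μ = θ) :
    TendstoInMeasure P (fun (n : ℕ) ω =>
      √n * (2 / ((n : ℝ) * ((n : ℝ) - 1)) *
        ∑ s ∈ Finset.range n, ∑ r ∈ Finset.range s, k (X r ω) (X s ω) - θ)
      - (√n)⁻¹ * ∑ r ∈ Finset.range n, 2 * g (X r ω)) atTop 0 := by
  have hμ : IsProbabilityMeasure μ := (hlaw 0).isProbabilityMeasure_iff.1 ‹_›
  have hX : ∀ r, AEMeasurable (X r) P := fun r => (hlaw r).aemeasurable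
  have hkx : ∀ x, Measurable (k x) := fun x => hm.of_uncurry_left
  have hkint : ∀ x, Integrable (k x) μ := fun x =>
    .of_bound (hkx x).aestronglyMeasurable C (.of_forall (hC x))
  have hKm : Measurable fun x => ∫ y, k x y ∂μ :=
    (hm.stronglyMeasurable.integral_prod_right (f := k)).measurable
  have hKC : ∀ x, |∫ y, k x y ∂μ| ≤ C := fun x => by
    simpa using norm_integral_le_of_norm_le_const (μ := μ) (f := k x) (C := C)
      (.of_forall fun y => (Real.norm_eq_abs _).trans_le (hC x y))
  have hKint : Integrable (fun x => ∫ y, k x y ∂μ) μ :=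
    .of_bound hKm.aestronglyMeasurable C (.of_forall hKC)
  have hθC : |θ| ≤ C := by
    rw [← hθ]
    simpa using norm_integral_le_of_norm_le_const (μ := μ) (f := fun x => ∫ y, k x y ∂μ) (C := C)
      (.of_forall fun x => (Real.norm_eq_abs _).trans_le (hKC x))
  have hgm : Measurable g := by
    rw [funext hg]
    exact hKm.sub_const θ
  have hgint : Integrable g μ := by
    rw [funext hg]
    exact hKint.sub (integrable_const _)
  have hg0 : ∫ x, g x ∂μ = 0 := by
    simp_rw [hg]
    rw [integral_sub hKint (integrable_const _), hθ]
    simp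
  have hgC : ∀ x, |g x| ≤ 2 * C := fun x => by
    rw [hg]
    linarith [abs_sub (∫ y, k x y ∂μ) θ, hKC x]
  -- `h` is bounded by `C + C + 2 C + 2 C`
  let h : α → α → ℝ := fun x y => k x y - θ - g x - g y
  have hhm : Measurable (Function.uncurry h) :=
    ((hm.sub_const θ).sub (hgm.comp measurable_fst)).sub (hgm.comp measurable_snd)
  have hhC : ∀ x y, |h x y| ≤ 6 * C := fun x y => by
    have h1 := hC x y
    have h2 := hgC x
    have h3 := hgC y
    rw [abs_le] at *
    constructor <;> simp only [h] <;> linarith [hθC.1, hθC.2, h1.1, h1.2, h2.1, h2.2, h3.1, h3.2]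
  have hhs : ∀ x y, h x y = h y x := fun x y => by simp only [h]; rw [hsymm x y]; ring
  have hdeg : ∀ x, ∫ y, h x y ∂μ = 0 := fun x => by
    have h1 : Integrable (fun y => k x y - θ) μ := (hkint x).sub (integrable_const _)
    have h2 : Integrable (fun y => k x y - θ - g x) μ := h1.sub (integrable_const _)
    simp only [h]
    rw [integral_sub h2 hgint, integral_sub h1 (integrable_const _),
      integral_sub (hkint x) (integrable_const _), hg0, hg]
    simp
  let D : ℕ → Ω → ℝ := fun n ω => 2 * √n / ((n : ℝ) * ((n : ℝ) - 1)) *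
    ∑ s ∈ Finset.range n, ∑ r ∈ Finset.range s, h (X r ω) (X s ω)
  have hDmem : ∀ n, MemLp (D n) 2 P := fun n => by
    have h1 : ∀ s r, MemLp (fun ω => h (X r ω) (X s ω)) 2 P := fun s r =>
      .of_bound (hhm.comp_aemeasurable ((hX r).prodMk (hX s))).aestronglyMeasurable (6 * C)
        (.of_forall fun ω => (Real.norm_eq_abs _).trans_le (hhC _ _))
    have h2 : MemLp (fun ω => ∑ s ∈ Finset.range n, ∑ r ∈ Finset.range s, h (X r ω) (X s ω)) 2 P :=
      memLp_finsetSum _ fun s _ => memLp_finsetSum _ fun r _ => h1 s r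
    exact h2.const_mul _
  have hD2 : ∀ n : ℕ, 2 ≤ n → ∫ ω, D n ω ^ 2 ∂P ≤ 4 * (6 * C) ^ 2 * (n / ((n : ℝ) - 1) ^ 2) := by
    intro n hn
    have hn' : (2 : ℝ) ≤ n := by exact_mod_cast hn
    have h1 : (n : ℝ) - 1 ≠ 0 := by linarith
    simp only [D, mul_pow]
    rw [integral_const_mul]
    refine (mul_le_mul_of_nonneg_left (integral_sq_sum_degenerate_le hlaw hindep hhm hhC hhs hdeg n)
      (by positivity)).trans_eq ?_
    rw [div_pow, mul_pow, Real.sq_sqrt (by positivity)]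
    field_simp
    ring
  have hlim : Tendsto (fun n : ℕ => 4 * (6 * C) ^ 2 * ((n : ℝ) / ((n : ℝ) - 1) ^ 2)) atTop
      (𝓝 0) := by
    have h1 : Tendsto (fun n : ℕ => 1 / (n : ℝ)) atTop (𝓝 0) := tendsto_one_div_atTop_nhds_zero_nat
    have h2 : Tendsto (fun n : ℕ => 4 * (6 * C) ^ 2 * (1 / (n : ℝ) / (1 - 1 / (n : ℝ)) ^ 2)) atTop
        (𝓝 (4 * (6 * C) ^ 2 * (0 / (1 - 0) ^ 2))) :=
      (h1.div ((tendsto_const_nhds.sub h1).pow 2) (by norm_num)).const_mul _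
    simp only [zero_div, mul_zero] at h2
    refine h2.congr' ?_
    filter_upwards [eventually_ge_atTop 2] with n hn
    have hn' : (2 : ℝ) ≤ n := by exact_mod_cast hn
    have h3 : (n : ℝ) - 1 ≠ 0 := by linarith
    field_simp
  have hDlim : Tendsto (fun n => ∫ ω, D n ω ^ 2 ∂P) atTop (𝓝 0) :=
    tendsto_of_tendsto_of_tendsto_of_le_of_le' tendsto_const_nhds hlim
      (.of_forall fun n => integral_nonneg fun ω => sq_nonneg _)
      ((eventually_ge_atTop 2).mono hD2)
  refine (tendstoInMeasure_zero_of_integral_sq hDmem hDlim).congr' ?_ .rfl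
  filter_upwards [eventually_ge_atTop 2] with n hn
  refine .of_forall fun ω => ?_
  exact (sqrt_mul_uStatistic_sub_projection hn (fun r s => k (X r ω) (X s ω))
    (fun r => g (X r ω)) θ).symm

end UStatistic

/-! ### Laws with continuous joint distribution function -/

section Ties

open scoped Topology

variable {d : ℕ} {μ : Measure (Fin d → ℝ)} [IsProbabilityMeasure μ]

/-- A law with continuous joint distribution function has no mass on the hyperplanes `x i = t`:
a jump of a marginal would be a jump of the joint distribution function. -/
theorem measure_eval_eq_zero (hμ : Continuous fun x : Fin d → ℝ => μ.real (Set.Iic x))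
    (i : Fin d) (t : ℝ) : μ {x | x i = t} = 0 := by
  -- the orthant `x ≤ a` has no mass on its face `x i = a i`: shrink it in the direction `i`
  have hface : ∀ a : Fin d → ℝ, μ {x | x ≤ a ∧ x i = a i} = 0 := by
    intro a
    have hle : ∀ s < a i, μ.real {x | x ≤ a ∧ x i = a i}
        ≤ μ.real (Set.Iic a) - μ.real (Set.Iic (Function.update a i s)) := by
      intro s hs
      have hsub : Set.Iic (Function.update a i s) ⊆ Set.Iic a :=
        Set.Iic_subset_Iic.2 (update_le_self_iff.2 hs.le)
      rw [← measureReal_sdiff hsub measurableSet_Iic]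
      refine measureReal_mono fun x hx => ⟨hx.1, fun hx' => ?_⟩
      have h1 : x i ≤ s := by simpa using hx' i
      linarith [hx.2]
    have hlim : Tendsto
        (fun s => μ.real (Set.Iic a) - μ.real (Set.Iic (Function.update a i s))) (𝓝[<] (a i))
        (𝓝 0) := by
      have h1 : Continuous
          fun s => μ.real (Set.Iic a) - μ.real (Set.Iic (Function.update a i s)) :=
        continuous_const.sub (hμ.comp (continuous_const.update i continuous_id))
      have h2 := h1.tendsto (a i)
      rw [Function.update_eq_self, sub_self] at h2
      exact h2.mono_left nhdsWithin_le_nhds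
    have h0 : μ.real {x | x ≤ a ∧ x i = a i} ≤ 0 :=
      ge_of_tendsto hlim (eventually_mem_nhdsWithin.mono fun s hs => hle s hs)
    exact (measureReal_eq_zero_iff).1 (le_antisymm h0 measureReal_nonneg)
  -- the hyperplane is a countable union of such faces
  refine measure_mono_null (t := ⋃ m : ℕ, {x | x ≤ Function.update (fun _ => (m : ℝ)) i t ∧
    x i = Function.update (fun _ => (m : ℝ)) i t i}) (fun x hx => ?_)
    (measure_iUnion_null fun m => hface _)
  have hx' : x i = t := hx
  obtain ⟨m, hm⟩ := exists_nat_ge (∑ j, |x j|)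
  refine Set.mem_iUnion.2 ⟨m, ?_, by simpa using hx'⟩
  refine le_update_iff.2 ⟨hx'.le, fun j _ => ?_⟩
  exact (le_abs_self _).trans
    ((Finset.single_le_sum (f := fun j => |x j|) (fun j _ => abs_nonneg _)
      (Finset.mem_univ j)).trans hm)

theorem ae_eval_ne (hμ : Continuous fun x : Fin d → ℝ => μ.real (Set.Iic x)) (i : Fin d) :
    ∀ᵐ z ∂(μ.prod μ), z.1 i ≠ z.2 i := by
  have hm : MeasurableSet {z : (Fin d → ℝ) × (Fin d → ℝ) | z.1 i = z.2 i} :=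
    measurableSet_eq_fun (by fun_prop) (by fun_prop)
  have h : (μ.prod μ) {z | z.1 i = z.2 i} = 0 := by
    rw [Measure.measure_prod_null hm]
    refine .of_forall fun x => ?_
    simpa [eq_comm] using measure_eval_eq_zero hμ i (x i)
  simpa [ae_iff] using h

end Ties

/-! ### The kernel of Kendall's tau -/

section Kernel

variable {d : ℕ}

theorem measurable_kernel (k : Pairs d) : Measurable (Function.uncurry (kernel k)) := by
  have h : MeasurableSet {z : (Fin d → ℝ) × (Fin d → ℝ) |
      0 < (z.1 k.1.1 - z.2 k.1.1) * (z.1 k.1.2 - z.2 k.1.2)} :=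
    measurableSet_lt (by fun_prop) (by fun_prop)
  exact ((Measurable.ite h measurable_const measurable_const).const_mul 2).sub_const 1

theorem abs_kernel_le (k : Pairs d) (x y : Fin d → ℝ) : |kernel k x y| ≤ 1 := by
  unfold kernel
  split_ifs <;> norm_num

theorem kernel_comm (k : Pairs d) (x y : Fin d → ℝ) : kernel k x y = kernel k y x := by
  unfold kernel
  rw [show (x k.1.1 - y k.1.1) * (x k.1.2 - y k.1.2)
    = (y k.1.1 - x k.1.1) * (y k.1.2 - x k.1.2) by ring]

/-- In the absence of ties the mean of the kernel is Kendall's tau. -/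
theorem integral_integral_kernel {μ : Measure (Fin d → ℝ)} [IsProbabilityMeasure μ]
    (hμ : Continuous fun x : Fin d → ℝ => μ.real (Set.Iic x)) (k : Pairs d) :
    ∫ x, ∫ y, kernel k x y ∂μ ∂μ = tau μ k := by
  let f : (Fin d → ℝ) × (Fin d → ℝ) → ℝ :=
    fun z => (z.1 k.1.1 - z.2 k.1.1) * (z.1 k.1.2 - z.2 k.1.2)
  have hf : Measurable f := by fun_prop
  have hpos : MeasurableSet {z | 0 < f z} := measurableSet_lt measurable_const hf
  have hneg : MeasurableSet {z | f z < 0} := measurableSet_lt hf measurable_const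
  have hint : Integrable (Function.uncurry (kernel k)) (μ.prod μ) :=
    .of_bound (measurable_kernel k).aestronglyMeasurable 1
      (.of_forall fun z => (Real.norm_eq_abs _).trans_le (abs_kernel_le k z.1 z.2))
  have hae : Function.uncurry (kernel k) =ᵐ[μ.prod μ]
      fun z => {z | 0 < f z}.indicator 1 z - {z | f z < 0}.indicator 1 z := by
    filter_upwards [ae_eval_ne hμ k.1.1, ae_eval_ne hμ k.1.2] with z h1 h2
    have h0 : f z ≠ 0 := mul_ne_zero (sub_ne_zero.2 h1) (sub_ne_zero.2 h2)
    change 2 * (if 0 < f z then 1 else 0) - 1 = _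
    rcases lt_or_gt_of_ne h0 with h | h
    · simp [Set.indicator, h, h.not_gt]
    · simp [Set.indicator, h, h.not_gt]; norm_num
  have hprod : ∫ x, ∫ y, kernel k x y ∂μ ∂μ = ∫ z, Function.uncurry (kernel k) z ∂(μ.prod μ) :=
    (integral_prod _ hint).symm
  rw [hprod, integral_congr_ae hae, integral_sub, integral_indicator_one hpos,
    integral_indicator_one hneg]
  · rfl
  · exact (integrable_const (1 : ℝ)).indicator hpos
  · exact (integrable_const (1 : ℝ)).indicator hneg

theorem measurable_hajek (μ : Measure (Fin d → ℝ)) [IsProbabilityMeasure μ] (k : Pairs d) :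
    Measurable (hajek μ k) :=
  ((measurable_kernel k).stronglyMeasurable.integral_prod_right (f := kernel k)).measurable.sub_const
    _

theorem abs_integral_kernel_le (μ : Measure (Fin d → ℝ)) [IsProbabilityMeasure μ] (k : Pairs d)
    (x : Fin d → ℝ) : |∫ y, kernel k x y ∂μ| ≤ 1 := by
  simpa using norm_integral_le_of_norm_le_const (μ := μ) (f := kernel k x) (C := 1)
    (.of_forall fun y => (Real.norm_eq_abs _).trans_le (abs_kernel_le k x y))

theorem memLp_hajek (μ : Measure (Fin d → ℝ)) [IsProbabilityMeasure μ] (k : Pairs d) :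
    MemLp (hajek μ k) 2 μ :=
  .of_bound (measurable_hajek μ k).aestronglyMeasurable (1 + |tau μ k|) (.of_forall fun x =>
    (abs_sub _ _).trans (add_le_add_left (abs_integral_kernel_le μ k x) _))

theorem integral_hajek {μ : Measure (Fin d → ℝ)} [IsProbabilityMeasure μ]
    (hμ : Continuous fun x : Fin d → ℝ => μ.real (Set.Iic x)) (k : Pairs d) :
    ∫ x, hajek μ k x ∂μ = 0 := by
  have h1 : Integrable (fun x => ∫ y, kernel k x y ∂μ) μ := by
    have := ((memLp_hajek μ k).integrable (by simp)).add (integrable_const (tau μ k))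
    simpa [hajek, Pi.add_def] using this
  simp only [hajek]
  rw [integral_sub h1 (integrable_const _), integral_integral_kernel hμ]
  simp

theorem aemeasurable_tauHat {Ω : Type*} [MeasurableSpace Ω] {P : Measure Ω}
    {X : ℕ → Ω → Fin d → ℝ} (hX : ∀ r, AEMeasurable (X r) P) (n : ℕ) (k : Pairs d) :
    AEMeasurable (fun ω => tauHat (fun r => X r ω) n k) P :=
  (Finset.aemeasurable_fun_sum _ fun s _ => Finset.aemeasurable_fun_sum _ fun r _ =>
    (measurable_kernel k).comp_aemeasurable ((hX r).prodMk (hX s))).const_mul _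

theorem card_pairs (d : ℕ) : Fintype.card (Pairs d) = d * (d - 1) / 2 := by
  rw [Fintype.card_subtype, Finset.card_filter, Fintype.sum_prod_type_right]
  have h : ∀ j : Fin d, (∑ i : Fin d, if i < j then 1 else 0) = (j : ℕ) := fun j => by
    rw [← Finset.card_filter, ← Fin.card_Iio j]
    congr 1
    ext i
    simp
  simp only [h]
  rw [Fin.sum_univ_eq_sum_range (fun i => i), Finset.sum_range_id]

end Kernel

/-! ### Asymptotic normality of the empirical Kendall tau vector -/

section Sample

open scoped Topology

variable {Ω : Type*} [MeasurableSpace Ω] {P : Measure Ω} [IsProbabilityMeasure P] {d : ℕ}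
  {μ : Measure (Fin d → ℝ)} [IsProbabilityMeasure μ] {X : ℕ → Ω → Fin d → ℝ}

/-- The central limit theorem for the Hájek projection of the estimator; the factor `2` accounts
for the `4` in `Σ = 4 cov g(X)`. -/
theorem tendstoInDistribution_hajek (hμ : Continuous fun x : Fin d → ℝ => μ.real (Set.Iic x))
    (hpos : (asympCov μ).PosSemidef) (hlaw : ∀ r, HasLaw (X r) μ P) (hindep : iIndepFun X P) :
    TendstoInDistribution (fun (n : ℕ) ω => (√n)⁻¹ • ∑ r ∈ Finset.range n,
        WithLp.toLp 2 fun k : Pairs d => 2 * hajek μ k (X r ω)) atTop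
      id (fun _ => P) (multivariateGaussian 0 (asympCov μ)) := by
  let G : (Fin d → ℝ) → EuclideanSpace ℝ (Pairs d) :=
    fun x => WithLp.toLp 2 fun k => 2 * hajek μ k x
  have hG : Measurable G :=
    (WithLp.measurable_toLp 2 _).comp
      (measurable_pi_lambda _ fun k => (measurable_hajek μ k).const_mul 2)
  have hcoord : ∀ k, MemLp (fun x => 2 * hajek μ k x) 2 μ := fun k => (memLp_hajek μ k).const_mul 2
  have hGmem : MemLp G 2 μ := by
    refine MemLp.of_eval_piLp fun k => hcoord k
  refine tendstoInDistribution_multivariateGaussian (Y := fun r ω => G (X r ω)) ?_ ?_ hpos ?_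
    (hindep.comp (fun _ => G) fun _ => hG) fun r => ?_
  · have h := hGmem
    rw [← (hlaw 0).map_eq] at h
    exact h.comp_of_map (hlaw 0).aemeasurable
  · intro k
    have h := (hlaw 0).integral_comp (hcoord k).aestronglyMeasurable
    refine h.trans ?_
    rw [integral_const_mul, integral_hajek hμ, mul_zero]
  · intro k l
    have h := (hlaw 0).covariance_comp (hcoord k).aemeasurable (hcoord l).aemeasurable
    refine h.trans ?_
    rw [covariance_const_mul_left, covariance_const_mul_right, asympCov, Matrix.of_apply]
    ring
  · have h : IdentDistrib (X r) (X 0) P P := ⟨(hlaw r).aemeasurable, (hlaw 0).aemeasurable,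
      (hlaw r).map_eq.trans (hlaw 0).map_eq.symm⟩
    exact h.comp hG

/-- Asymptotic normality of the estimator: `√n (τ̂ - τ)` tends to `N(0, Σ)` in distribution. -/
theorem tendstoInDistribution_tauHat (hμ : Continuous fun x : Fin d → ℝ => μ.real (Set.Iic x))
    (hpos : (asympCov μ).PosSemidef) (hlaw : ∀ r, HasLaw (X r) μ P) (hindep : iIndepFun X P) :
    TendstoInDistribution
      (fun (n : ℕ) ω => WithLp.toLp 2 (√n • (tauHat (fun r => X r ω) n - tau μ))) atTop
      id (fun _ => P) (multivariateGaussian 0 (asympCov μ)) := by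
  refine tendstoInDistribution_of_tendstoInMeasure_sub _ _
    (tendstoInDistribution_hajek hμ hpos hlaw hindep) ?_ fun n => ?_
  · have h := tendstoInMeasure_pi (Y := 0) fun k : Pairs d =>
      tendstoInMeasure_uStatistic_sub_projection hlaw hindep (measurable_kernel k)
        (abs_kernel_le k) (kernel_comm k) (fun x => (rfl : hajek μ k x = _))
        (integral_integral_kernel hμ k)
    have h2 := tendstoInMeasure_comp_of_continuousAt (c := (0 : Pairs d → ℝ)) h
      (PiLp.continuous_toLp 2 _).continuousAt
    convert! h2 using 1
    ext n ω k
    simp [tauHat, Finset.mul_sum]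
  · refine (WithLp.measurable_toLp 2 _).comp_aemeasurable (aemeasurable_pi_lambda _ fun k => ?_)
    exact ((aemeasurable_tauHat (fun r => (hlaw r).aemeasurable) n k).sub_const _).const_mul (√n)

end Sample

/-! ### Measurability of functions of random matrices -/

section RandomMatrix

variable {Ω ι κ ν : Type*} [MeasurableSpace Ω] {P : Measure Ω}

theorem aemeasurable_matrix_mul [Fintype κ] {A : Ω → Matrix ι κ ℝ} {B : Ω → Matrix κ ν ℝ}
    (hA : ∀ i j, AEMeasurable (fun ω => A ω i j) P)
    (hB : ∀ i j, AEMeasurable (fun ω => B ω i j) P) (i : ι) (j : ν) :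
    AEMeasurable (fun ω => (A ω * B ω) i j) P := by
  simp only [Matrix.mul_apply]
  exact Finset.aemeasurable_fun_sum _ fun k _ => (hA i k).mul (hB k j)

theorem aemeasurable_matrix_det [Fintype ι] [DecidableEq ι] {A : Ω → Matrix ι ι ℝ}
    (hA : ∀ i j, AEMeasurable (fun ω => A ω i j) P) : AEMeasurable (fun ω => (A ω).det) P := by
  simp only [Matrix.det_apply']
  exact Finset.aemeasurable_fun_sum _ fun σ _ =>
    (Finset.aemeasurable_fun_prod _ fun i _ => hA (σ i) i).const_mul _

theorem aemeasurable_matrix_inv [Fintype ι] [DecidableEq ι] {A : Ω → Matrix ι ι ℝ}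
    (hA : ∀ i j, AEMeasurable (fun ω => A ω i j) P) (i j : ι) :
    AEMeasurable (fun ω => (A ω)⁻¹ i j) P := by
  simp only [Matrix.inv_def, Ring.inverse_eq_inv', Matrix.smul_apply, Matrix.adjugate_apply,
    smul_eq_mul]
  refine (aemeasurable_matrix_det hA).inv.mul (aemeasurable_matrix_det fun k l => ?_)
  by_cases hk : k = j
  · subst hk
    simp
  · simpa [Matrix.updateRow_ne hk] using hA k l

theorem aemeasurable_statMatrix [Fintype ι] [DecidableEq ι] [Fintype κ] [DecidableEq κ]
    (B : Matrix ι κ ℝ) {S : Ω → Matrix ι ι ℝ} (hS : ∀ i j, AEMeasurable (fun ω => S ω i j) P)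
    (i j : ι) : AEMeasurable (fun ω => statMatrix B (S ω) i j) P := by
  have hI := aemeasurable_matrix_inv hS
  have hB : ∀ i j, AEMeasurable (fun _ : Ω => B i j) P := fun _ _ => aemeasurable_const
  have hBT : ∀ i j, AEMeasurable (fun _ : Ω => Bᵀ i j) P := fun _ _ => aemeasurable_const
  have hG : ∀ i j, AEMeasurable (fun ω => (1 - Gam B (S ω)) i j) P := fun i j => by
    have h := aemeasurable_matrix_mul (aemeasurable_matrix_mul (aemeasurable_matrix_mul hB
      (aemeasurable_matrix_inv (aemeasurable_matrix_mul (aemeasurable_matrix_mul hBT hI) hB)))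
      hBT) hI i j
    exact h.const_sub ((1 : Matrix ι ι ℝ) i j)
  exact aemeasurable_matrix_mul (aemeasurable_matrix_mul (fun i j => hG j i) hI) hG i j

theorem aemeasurable_dotProduct_mulVec [Fintype ι] {M : Ω → Matrix ι ι ℝ} {t : Ω → ι → ℝ}
    (hM : ∀ i j, AEMeasurable (fun ω => M ω i j) P) (ht : ∀ i, AEMeasurable (fun ω => t ω i) P) :
    AEMeasurable (fun ω => t ω ⬝ᵥ (M ω *ᵥ t ω)) P := by
  simp only [dotProduct, Matrix.mulVec]
  exact Finset.aemeasurable_fun_sum _ fun i _ => (ht i).mul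
    (Finset.aemeasurable_fun_sum _ fun j _ => (hM i j).mul (ht j))

end RandomMatrix

end KendallTest

/-! ### The limit law of the statistic -/

theorem mainTheorem6 {Ω : Type*} [MeasurableSpace Ω] (P : Measure Ω) [IsProbabilityMeasure P]
    {d L : ℕ} (hL : L < d * (d - 1) / 2)
    -- the common law of the observations has a continuous distribution function
    (μ : Measure (Fin d → ℝ)) [IsProbabilityMeasure μ]
    (hμ : Continuous fun x : Fin d → ℝ => μ.real (Set.Iic x))
    (hpos : (KendallTest.asympCov μ).PosDef)
    -- the random sample
    (X : ℕ → Ω → Fin d → ℝ) (hlaw : ∀ r, HasLaw (X r) μ P) (hindep : iIndepFun X P)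
    -- the known matrix `B` and the null hypothesis
    (B : Matrix (KendallTest.Pairs d) (Fin L) ℝ) (hB : B.rank = L)
    (hH0 : KendallTest.NullHypothesis μ B)
    -- random matrices `Sig n` such that `n • Sig n` is consistent for the asymptotic covariance
    (Sig : ℕ → Ω → Matrix (KendallTest.Pairs d) (KendallTest.Pairs d) ℝ)
    (hmeas : ∀ n k l, AEMeasurable (fun ω => Sig n ω k l) P)
    (hcons : ∀ k l, TendstoInMeasure P (fun (n : ℕ) ω => (n : ℝ) * Sig n ω k l) atTop
      (fun _ => KendallTest.asympCov μ k l)) :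
    TendstoInDistribution
      (fun n ω => KendallTest.euclideanStat B (Sig n ω) (KendallTest.tauHat (fun r => X r ω) n))
      atTop (id : ℝ → ℝ) (fun _ => P) (KendallTest.chiSquared (d * (d - 1) / 2 - L)) := by
  obtain ⟨β, -, hβ⟩ := hH0
  have hB' : B.rank = Fintype.card (Fin L) := by simpa using hB
  set A := KendallTest.asympCov μ
  have hdet : A.det ≠ 0 := hpos.det_pos.ne'
  have hgram : (Bᵀ * A⁻¹ * B).det ≠ 0 := (KendallTest.gram_posDef hpos hB').det_pos.ne'
  -- `T n` is the rescaled estimate of `A`, and `Z n` the rescaled error of the estimator of `τ`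
  let T : ℕ → Ω → KendallTest.Pairs d → KendallTest.Pairs d → ℝ := fun n ω => (n : ℝ) • Sig n ω
  let Z : ℕ → Ω → EuclideanSpace ℝ (KendallTest.Pairs d) := fun n ω =>
    WithLp.toLp 2 (√n • (KendallTest.tauHat (fun r => X r ω) n - KendallTest.tau μ))
  let M : (KendallTest.Pairs d → KendallTest.Pairs d → ℝ) →
      KendallTest.Pairs d → KendallTest.Pairs d → ℝ := KendallTest.statMatrix B
  have hT : TendstoInMeasure P T atTop fun _ => A :=
    KendallTest.tendstoInMeasure_pi fun k => KendallTest.tendstoInMeasure_pi fun l => hcons k l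
  have hTm : ∀ n k l, AEMeasurable (fun ω => T n ω k l) P := fun n k l =>
    (hmeas n k l).const_mul (n : ℝ)
  have hZ : TendstoInDistribution Z atTop id (fun _ => P) (multivariateGaussian 0 A) :=
    KendallTest.tendstoInDistribution_tauHat hμ hpos.posSemidef hlaw hindep
  have hMT : TendstoInMeasure P (fun n ω => M (T n ω)) atTop fun _ => M A :=
    KendallTest.tendstoInMeasure_comp_of_continuousAt hT
      (KendallTest.continuousAt_statMatrix B hdet hgram)
  have hslutsky := hZ.continuous_comp_prodMk_of_tendstoInMeasure_const
    (g := fun q : EuclideanSpace ℝ (KendallTest.Pairs d) ×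
      (KendallTest.Pairs d → KendallTest.Pairs d → ℝ) => q.1.ofLp ⬝ᵥ (Matrix.of q.2 *ᵥ q.1.ofLp))
    (by fun_prop) hMT fun n => aemeasurable_pi_lambda _ fun k => aemeasurable_pi_lambda _ fun l =>
      KendallTest.aemeasurable_statMatrix B (hTm n) k l
  -- off the event that one of the two matrices to be inverted is singular, which has vanishing
  -- probability, the statistic is the quadratic form in `Z n` with matrix `M (T n)`
  have hU : {S : KendallTest.Pairs d → KendallTest.Pairs d → ℝ | (Matrix.of S).det ≠ 0 ∧
      (Bᵀ * (Matrix.of S)⁻¹ * B).det ≠ 0} ∈ nhds A := by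
    have h1 : ContinuousAt (fun S : Matrix (KendallTest.Pairs d) (KendallTest.Pairs d) ℝ => S.det)
      A := by fun_prop
    have h2 : ContinuousAt (fun S : Matrix (KendallTest.Pairs d) (KendallTest.Pairs d) ℝ =>
        (Bᵀ * S⁻¹ * B).det) A :=
      ContinuousAt.comp (g := fun G : Matrix (Fin L) (Fin L) ℝ => G.det) (by fun_prop)
        (KendallTest.continuousAt_gram B hdet)
    exact (h1.eventually_ne hdet).and (h2.eventually_ne hgram)
  have hdiff := KendallTest.tendstoInMeasure_sub_of_eq
    (X := fun n ω => (Z n ω).ofLp ⬝ᵥ (Matrix.of (M (T n ω)) *ᵥ (Z n ω).ofLp))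
    (Y := fun n ω =>
      KendallTest.euclideanStat B (Sig n ω) (KendallTest.tauHat (fun r => X r ω) n))
    (KendallTest.tendsto_measure_notMem_of_mem_nhds hT hU) (by
      filter_upwards [eventually_gt_atTop 0] with n hn ω hω
      obtain ⟨h1, h2⟩ := not_not.1 hω
      rw [KendallTest.euclideanStat_eq_smul B (Nat.cast_pos.2 hn) h1 h2 _ β, ← hβ,
        KendallTest.euclideanStat_eq_dotProduct]
      rfl)
  have hmain := tendstoInDistribution_of_tendstoInMeasure_sub _ _ hslutsky hdiff fun n => by
    simp only [KendallTest.euclideanStat_eq_dotProduct]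
    exact KendallTest.aemeasurable_dotProduct_mulVec
      (KendallTest.aemeasurable_statMatrix B (hmeas n))
      (KendallTest.aemeasurable_tauHat (fun r => (hlaw r).aemeasurable) n)
  have hchi : (multivariateGaussian 0 A).map (fun z => z.ofLp ⬝ᵥ (Matrix.of (M A) *ᵥ z.ofLp))
      = KendallTest.chiSquared (d * (d - 1) / 2 - L) := by
    have h := KendallTest.map_euclideanStat_multivariateGaussian hpos hB'
    rw [KendallTest.card_pairs, Fintype.card_fin] at h
    rw [← h]
    simp only [KendallTest.euclideanStat_eq_dotProduct]
    rfl
  -- `hmain` and the goal have limit variables on different spaces, with the same law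
  refine ⟨hmain.forall_aemeasurable, aemeasurable_id, ?_⟩
  convert! hmain.tendsto using 2
  exact congrArg nhds (Subtype.ext (Measure.map_id.trans hchi.symm))
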